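/- Definitions. Let $G$ be a locally compact $\sigma$-compact topological group acting on a Polish space $X$ with Borel probability measure $\mu$. We say that $(X,\mu)$ is \emph{orbit-regular under $G$ with exceptional set $X_0\subseteq X$} if (1) $X_0$ is closed, is a union of $G$-orbits, $\mu(X_0)=0$, and $G$ acts freely on $X\setminus X_0$; and (2) there is a disintegration $(\mu_o)_{o}$ of $\mu$ on $X\setminus X_0$ over the orbit space $Y=(X\setminus X_0)/G$ (with the quotient topology, its Borel $\sigma$-algebra, and the image measure $\nu$ of $\mu|_{X\setminus X_0}$), that is, every $\mu_o$ is a Radon measure on $X$, for $\nu$-almost every $o$ the measure $\mu_o$ is a probability measure for which the complement of the orbit $o$ is negligible, and $\int_{X\setminus X_0} f\,d\mu=\int_Y\int f\,d\mu_o\,d\nu(o)$ for every measurable $f\ge 0$, such that for every orbit $o$ and every $x\in o$ the measure $\mu_o$ and the image of the left Haar measure of $G$ under $g\mapsto gx$ are mutually absolutely continuous. We say that $(X,\mu)$ is \emph{orbit-regular under $G$} if this holds for some $X_0$. Let $G_{GP}$ be the group of the maps $z\mapsto az+b$ of $\mathbb{R}^d$ with $a>0$, $b\in\mathbb{R}^d$,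 under composition, with the topology of $\mathbb{R}_{>0}\times\mathbb{R}^d$. Proposition. Let $n>d$, let $x_1,\dots,x_n\in\mathbb{R}^d$ be distinct, let $[x_{1:n}]$ be the $d\times n$ matrix with columns $x_1,\dots,x_n$, and suppose $\operatorname{rank}[x_{1:n}]=d$. Let $\sigma_x,\sigma_y>0$, $\beta\in\mathbb{R}^d$, let $K_{ij}=\exp\bigl(-\|x_i-x_j\|^2/(2\sigma_x^2)\bigr)$, and let $\mu=\mathcal{N}([x_{1:n}]^T\beta,\ \sigma_y^2K)$ on $\mathbb{R}^n$. Let $(a,b)\in G_{GP}$ act on $\mathbb{R}^n$ by $y\mapsto ay+[x_{1:n}]^Tb$. Then: (i) $(\mathbb{R}^n,\mu)$ is orbit-regular under $G_{GP}$, and the exceptional set can be taken to be $X_0$, the linear subspace of $\mathbb{R}^n$ spanned by the rows of $[x_{1:n}]$; (ii) a point $y\in\mathbb{R}^n$ has trivial stabilizer in $G_{GP}$ if and only if $y\notin X_0$; (iii) there is a homeomorphism $h$ from the orbit space $(\mathbb{R}^n\setminus X_0)/G_{GP}$ onto the unit sphere $S^{n-d-1}\subset\mathbb{R}^{n-d}$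 such that the composition of the quotient map $\mathbb{R}^n\setminus X_0\to(\mathbb{R}^n\setminus X_0)/G_{GP}$ with $h$ is a smooth submersion. -/

import Mathlib

open MeasureTheory Matrix
open scoped ContDiff Manifold

noncomputable section

namespace OrbitReg

/-! ### Orbit spaces and orbit regularity -/

section General

variable (G : Type*) {X : Type*} [Group G] [MulAction G X]

/-- Two points of the complement of `X₀` are equivalent if they lie in the same `G`-orbit of `X`.
For a union of orbits `X₀` this is the orbit relation of `G` on the complement of `X₀`. -/
def orbitSetoid (X₀ : Set X) : Setoid ↥(X₀ᶜ) :=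
  (MulAction.orbitRel G X).comap Subtype.val

/-- The orbit space `(X \ X₀) / G`. -/
def OrbitSpace (X₀ : Set X) : Type _ :=
  Quotient (orbitSetoid G X₀)

/-- The quotient map `X \ X₀ → (X \ X₀) / G`. -/
def OrbitSpace.mk (X₀ : Set X) (x : ↥(X₀ᶜ)) : OrbitSpace G X₀ :=
  Quotient.mk (orbitSetoid G X₀) x

/-- The orbit, as a subset of `X`, that a point of the orbit space stands for. -/
def OrbitSpace.fiber (X₀ : Set X) (o : OrbitSpace G X₀) : Set X :=
  Subtype.val '' (OrbitSpace.mk G X₀ ⁻¹' {o})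

section Top

variable [TopologicalSpace X]

/-- The orbit space carries the quotient topology. -/
instance OrbitSpace.instTopologicalSpace (X₀ : Set X) : TopologicalSpace (OrbitSpace G X₀) :=
  inferInstanceAs (TopologicalSpace (Quotient (orbitSetoid G X₀)))

/-- The orbit space carries the Borel σ-algebra of the quotient topology. -/
instance OrbitSpace.instMeasurableSpace (X₀ : Set X) : MeasurableSpace (OrbitSpace G X₀) :=
  borel _

instance OrbitSpace.instBorelSpace (X₀ : Set X) : BorelSpace (OrbitSpace G X₀) :=
  ⟨rfl⟩

variable [MeasurableSpace X]

/-- The law of the orbit: the image under the quotient map of the restriction of `μ` to the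
complement of `X₀`. -/
def orbitLaw (μ : Measure X) (X₀ : Set X) : Measure (OrbitSpace G X₀) :=
  (μ.comap (Subtype.val : ↥(X₀ᶜ) → X)).map (OrbitSpace.mk G X₀)

/-- `κ` is a disintegration of `μ` on `X \ X₀` over the orbit space: every `κ o` is a Radon measure,
almost every `κ o` is a probability measure for which the complement of the orbit `o` is negligible,
and integrals against `μ` are iterated integrals. (The formula for nonnegative functions is
equivalent to the one for extended real functions whose integral is defined: split into positive
and negative parts.) -/
structure IsOrbitDisintegration (μ : Measure X) (X₀ : Set X)
    (κ : OrbitSpace G X₀ → Measure X) : Prop where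
  radon : ∀ o, IsLocallyFiniteMeasure (κ o) ∧ (κ o).InnerRegular
  fiberwise : ∀ᵐ o ∂(orbitLaw G μ X₀),
    IsProbabilityMeasure (κ o) ∧ κ o (OrbitSpace.fiber G X₀ o)ᶜ = 0
  aemeasurable : ∀ f : X → ENNReal, Measurable f →
    AEMeasurable (fun o ↦ ∫⁻ x, f x ∂(κ o)) (orbitLaw G μ X₀)
  lintegral_eq : ∀ f : X → ENNReal, Measurable f →
    ∫⁻ x in X₀ᶜ, f x ∂μ = ∫⁻ o, ∫⁻ x, f x ∂(κ o) ∂(orbitLaw G μ X₀)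

/-- The left-invariant measure on the orbit of `x`: the image of the left Haar measure of `G`
under `g ↦ g • x`. On a free orbit this map is a bijection onto the orbit which turns left
translations of `G` into the action; a different base point of the same orbit changes the measure
by a positive constant only. -/
def orbitHaar [TopologicalSpace G] [IsTopologicalGroup G] [LocallyCompactSpace G]
    [MeasurableSpace G] [BorelSpace G] (x : X) : Measure X :=
  (Measure.haar : Measure G).map (fun g ↦ g • x)

/-- The standard Borel probability space `(X, μ)` is orbit-regular under the locally compact
σ-compact group `G`, with exceptional set `X₀`. -/
structure OrbitRegularOff [TopologicalSpace G] [IsTopologicalGroup G] [LocallyCompactSpace G]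
    [SigmaCompactSpace G] [MeasurableSpace G] [BorelSpace G] [PolishSpace X] [BorelSpace X]
    (μ : Measure X) [IsProbabilityMeasure μ] (X₀ : Set X) : Prop where
  /-- `X₀` is a union of orbits. -/
  smul_mem : ∀ (g : G), ∀ x ∈ X₀, g • x ∈ X₀
  isClosed : IsClosed X₀
  null : μ X₀ = 0
  /-- `G` acts freely on the complement of `X₀`. -/
  free : ∀ x, x ∉ X₀ → ∀ g : G, g • x = x → g = 1
  /-- Some disintegration of `μ` over the orbits is fibrewise equivalent to the left-invariant
  measures on the orbits. -/
  disintegration : ∃ κ : OrbitSpace G X₀ → Measure X, IsOrbitDisintegration G μ X₀ κ ∧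
    ∀ x : ↥(X₀ᶜ), κ (OrbitSpace.mk G X₀ x) ≪ orbitHaar G (x : X) ∧
      orbitHaar G (x : X) ≪ κ (OrbitSpace.mk G X₀ x)

/-- The standard Borel probability space `(X, μ)` is orbit-regular under the action of `G`. -/
def OrbitRegular [TopologicalSpace G] [IsTopologicalGroup G] [LocallyCompactSpace G]
    [SigmaCompactSpace G] [MeasurableSpace G] [BorelSpace G] [PolishSpace X] [BorelSpace X]
    (μ : Measure X) [IsProbabilityMeasure μ] : Prop :=
  ∃ X₀ : Set X, OrbitRegularOff G μ X₀

end Top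

end General

/-- Smooth submersions between finite-dimensional manifolds without boundary: smooth maps whose
differential is surjective everywhere. -/
def IsSmoothSubmersion {p q : ℕ} {M N : Type*}
    [TopologicalSpace M] [ChartedSpace (EuclideanSpace ℝ (Fin p)) M]
    [TopologicalSpace N] [ChartedSpace (EuclideanSpace ℝ (Fin q)) N] (f : M → N) : Prop :=
  ContMDiff (𝓡 p) (𝓡 q) ∞ f ∧
    ∀ y : M, Function.Surjective (mfderiv (𝓡 p) (𝓡 q) f y)

/-! ### The group of positive scalings and translations of `ℝᵈ` -/

/-- The group of maps `z ↦ a z + b` of `ℝᵈ` with `a > 0`. -/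
@[ext]
structure GPGroup (d : ℕ) where
  /-- the scaling factor -/
  a : ℝ
  a_pos : 0 < a
  /-- the translation vector -/
  b : EuclideanSpace ℝ (Fin d)

namespace GPGroup

variable {d : ℕ}

/-- Multiplication is composition of the maps `z ↦ a z + b`. -/
instance : Mul (GPGroup d) :=
  ⟨fun g h ↦ ⟨g.a * h.a, mul_pos g.a_pos h.a_pos, g.a • h.b + g.b⟩⟩

instance : One (GPGroup d) := ⟨⟨1, one_pos, 0⟩⟩

instance : Inv (GPGroup d) := ⟨fun g ↦ ⟨g.a⁻¹, inv_pos.2 g.a_pos, -(g.a⁻¹ • g.b)⟩⟩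

@[simp] lemma mul_a (g h : GPGroup d) : (g * h).a = g.a * h.a := rfl
@[simp] lemma mul_b (g h : GPGroup d) : (g * h).b = g.a • h.b + g.b := rfl
@[simp] lemma one_a : (1 : GPGroup d).a = 1 := rfl
@[simp] lemma one_b : (1 : GPGroup d).b = 0 := rfl
@[simp] lemma inv_a (g : GPGroup d) : (g⁻¹).a = g.a⁻¹ := rfl
@[simp] lemma inv_b (g : GPGroup d) : (g⁻¹).b = -(g.a⁻¹ • g.b) := rfl

instance : Group (GPGroup d) :=
  Group.ofLeftAxioms
    (fun g h k ↦ by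
      ext1
      · simp [mul_assoc]
      · simp [smul_add, smul_smul, add_assoc])
    (fun g ↦ by ext1 <;> simp)
    (fun g ↦ by
      ext1
      · simp [inv_mul_cancel₀ g.a_pos.ne']
      · simp)

/-- The coordinates `(a, b)` of a group element. -/
def toProd (g : GPGroup d) : ℝ × EuclideanSpace ℝ (Fin d) := (g.a, g.b)

/-- The topology of `ℝ_{>0} × ℝᵈ`. -/
instance : TopologicalSpace (GPGroup d) := TopologicalSpace.induced toProd inferInstance

instance : MeasurableSpace (GPGroup d) := borel _

instance : BorelSpace (GPGroup d) := ⟨rfl⟩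

lemma isInducing_toProd : Topology.IsInducing (toProd (d := d)) := ⟨rfl⟩

lemma continuous_a : Continuous (GPGroup.a : GPGroup d → ℝ) :=
  continuous_fst.comp isInducing_toProd.continuous

lemma continuous_b : Continuous (GPGroup.b : GPGroup d → EuclideanSpace ℝ (Fin d)) :=
  continuous_snd.comp isInducing_toProd.continuous

instance : IsTopologicalGroup (GPGroup d) where
  continuous_mul := by
    refine isInducing_toProd.continuous_iff.2 ?_
    have ha := continuous_a (d := d)
    have hb := continuous_b (d := d)
    exact ((ha.comp continuous_fst).mul (ha.comp continuous_snd)).prodMk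
      (((ha.comp continuous_fst).smul (hb.comp continuous_snd)).add (hb.comp continuous_fst))
  continuous_inv := by
    refine isInducing_toProd.continuous_iff.2 ?_
    have ha := (continuous_a (d := d)).inv₀ (fun g ↦ g.a_pos.ne')
    exact ha.prodMk (ha.smul continuous_b).neg

lemma isOpenEmbedding_toProd : Topology.IsOpenEmbedding (toProd (d := d)) where
  toIsInducing := isInducing_toProd
  injective := fun g h hgh ↦ GPGroup.ext (congrArg Prod.fst hgh) (congrArg Prod.snd hgh)
  isOpen_range := by
    have : Set.range (toProd (d := d)) = {p | 0 < p.1} := by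
      ext p
      exact ⟨by rintro ⟨g, rfl⟩; exact g.a_pos, fun hp ↦ ⟨⟨p.1, hp, p.2⟩, rfl⟩⟩
    rw [this]
    exact isOpen_lt continuous_const continuous_fst

instance : LocallyCompactSpace (GPGroup d) := isOpenEmbedding_toProd.locallyCompactSpace

instance : SecondCountableTopology (GPGroup d) := isInducing_toProd.secondCountableTopology

instance : SigmaCompactSpace (GPGroup d) := inferInstance

end GPGroup

/-! ### The Gaussian process model -/

variable {n d : ℕ}

/-- The `d × n` matrix `[x₁, …, xₙ]` with the feature vectors as its columns. -/
def design (x : Fin n → EuclideanSpace ℝ (Fin d)) : Matrix (Fin d) (Fin n) ℝ :=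
  Matrix.of fun j i ↦ x i j

/-- The vector `[x₁, …, xₙ]ᵀ b` of `ℝⁿ`. -/
def linMean (x : Fin n → EuclideanSpace ℝ (Fin d)) (b : EuclideanSpace ℝ (Fin d)) :
    EuclideanSpace ℝ (Fin n) :=
  WithLp.toLp 2 ((design x)ᵀ *ᵥ WithLp.ofLp b)

/-- The kernel matrix `K(v, w)` of the RBF kernel with lengthscale `σ`. -/
def rbfKernel {m k : ℕ} (σ : ℝ) (v : Fin m → EuclideanSpace ℝ (Fin d))
    (w : Fin k → EuclideanSpace ℝ (Fin d)) : Matrix (Fin m) (Fin k) ℝ :=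
  Matrix.of fun i j ↦ Real.exp (-‖v i - w j‖ ^ 2 / (2 * σ ^ 2))

/-- The marginal law `𝒩([x₁, …, xₙ]ᵀ β, σ_y² K(x, x))` of the observations. -/
abbrev gpLaw (σx σy : ℝ) (x : Fin n → EuclideanSpace ℝ (Fin d)) (β : EuclideanSpace ℝ (Fin d)) :
    Measure (EuclideanSpace ℝ (Fin n)) :=
  ProbabilityTheory.multivariateGaussian (linMean x β) (σy ^ 2 • rbfKernel σx x x)

/-- The action `y ↦ a y + [x₁, …, xₙ]ᵀ b` on observations at the locations `x₁, …, xₙ`. -/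
abbrev gpAction (x : Fin n → EuclideanSpace ℝ (Fin d)) :
    MulAction (GPGroup d) (EuclideanSpace ℝ (Fin n)) where
  smul g y := g.a • y + linMean x g.b
  one_smul y := by
    change (1 : ℝ) • y + linMean x 0 = y
    simp [linMean]
  mul_smul g h y := by
    change (g.a * h.a) • y + linMean x (g.a • h.b + g.b)
      = g.a • (h.a • y + linMean x h.b) + linMean x g.b
    simp [linMean, Matrix.mulVec_add, Matrix.mulVec_smul, smul_add, smul_smul, add_assoc]

/-- The linear subspace of `ℝⁿ` spanned by the rows of `[x₁, …, xₙ]`. -/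
def rowSpace (x : Fin n → EuclideanSpace ℝ (Fin d)) : Submodule ℝ (EuclideanSpace ℝ (Fin n)) :=
  Submodule.span ℝ (Set.range fun j ↦ WithLp.toLp 2 ((design x) j))

/-- The complement of the row space, as an open submanifold of `ℝⁿ`. -/
def rowCompl (x : Fin n → EuclideanSpace ℝ (Fin d)) :
    TopologicalSpace.Opens (EuclideanSpace ℝ (Fin n)) :=
  ⟨(rowSpace x : Set (EuclideanSpace ℝ (Fin n)))ᶜ,
    (rowSpace x).closed_of_finiteDimensional.isOpen_compl⟩

/-- The orbit space `(ℝⁿ \ X₀) / G` for the row space `X₀`. -/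
abbrev gpOrbitSpace (x : Fin n → EuclideanSpace ℝ (Fin d)) : Type :=
  letI := gpAction x
  OrbitSpace (GPGroup d) (rowSpace x : Set (EuclideanSpace ℝ (Fin n)))

/-- The quotient map `ℝⁿ \ X₀ → (ℝⁿ \ X₀) / G` for the row space `X₀`. -/
def gpQuot (x : Fin n → EuclideanSpace ℝ (Fin d)) (y : rowCompl x) : gpOrbitSpace x :=
  letI := gpAction x
  OrbitSpace.mk (GPGroup d) (rowSpace x : Set (EuclideanSpace ℝ (Fin n))) ⟨y.1, y.2⟩

end OrbitReg

end

/-! Choose linear coordinates `(b', w)` on ℝⁿ with `b'` running along the row space and `w` along a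
complement. There `(a, b)` acts by `(b', w) ↦ (a b' + b, a w)`, so off `w = 0` every point is
uniquely `g • (0, u)` with `|u| = 1`. The complement of the row space is thus equivariantly `S × G`,
with `S` the unit sphere and `G` acting by left translation on the second factor
(`gpTrivialization`). Freeness, the orbit space and the submersion can be read off from this
product.

For the measure only its null sets matter. The points `x i` are distinct, so the kernel matrix is
positive definite (`posDef_rbfKernel`) and the Gaussian law has the null sets of Lebesgue measure.
It is therefore quasi-invariant under invertible affine maps and ignores proper subspaces. A finite
measure on `S × G` that is quasi-invariant under left translations is equivalent to its marginal
times Haar measure (`null_iff_of_quasiInvariant`), so its conditional measures are almost everywhere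
equivalent to Haar. `orbitRegularOff_of_trivialization` carries them back to the orbits. -/

noncomputable section

namespace OrbitReg

/-! ### Quasi-invariant measures on `S × G` -/

section QuasiInvariant

open ProbabilityTheory

variable {S G : Type*} [MeasurableSpace S] [Group G] [TopologicalSpace G] [IsTopologicalGroup G]
  [LocallyCompactSpace G] [MeasurableSpace G] [BorelSpace G] [SecondCountableTopology G]

/-- A finite measure on `S × G` whose null sets are preserved by the left translations of `G` has
the same null sets as the product of its marginal on `S` with the Haar measure. -/
lemma null_iff_of_quasiInvariant (m : Measure (S × G)) [IsFiniteMeasure m]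
    (hm : ∀ g : G, Measure.QuasiMeasurePreserving (fun p : S × G ↦ (p.1, g * p.2)) m m)
    {N : Set (S × G)} (hN : MeasurableSet N) :
    m N = 0 ↔ (m.fst.prod (Measure.haar : Measure G)) N = 0 := by
  set lam : Measure G := Measure.haar
  -- Fubini for the set of pairs `(g, p)` with `g • p ∈ N`. Slices at fixed `g` are translates of
  -- `N`, whose nullity is that of `N`; slices at fixed `p` see only Haar measure.
  set A : Set (G × (S × G)) := {q | (q.2.1, q.1 * q.2.2) ∈ N}
  have hA : MeasurableSet A :=
    (show Measurable fun q : G × (S × G) ↦ (q.2.1, q.1 * q.2.2) by fun_prop) hN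
  have h1 : m N = 0 ↔ (lam.prod m) A = 0 := by
    rw [Measure.measure_prod_null hA]
    constructor
    · intro h
      exact Filter.Eventually.of_forall fun g ↦ (hm g).preimage_null h
    · intro h
      obtain ⟨g, hg⟩ := h.exists
      have := (hm g⁻¹).preimage_null hg
      convert this using 2
      ext p
      simp [A]
  have hA' : MeasurableSet (Prod.swap ⁻¹' A : Set ((S × G) × G)) := measurable_swap hA
  have h2 : (lam.prod m) A = 0 ↔ (m.prod lam) (Prod.swap ⁻¹' A) = 0 := by
    rw [← Measure.prod_swap, Measure.map_apply measurable_swap hA]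
  have h3 : (m.prod lam) (Prod.swap ⁻¹' A) = 0 ↔ ∀ᵐ p ∂m, lam (Prod.mk p.1 ⁻¹' N) = 0 := by
    rw [Measure.measure_prod_null hA']
    refine Filter.eventually_congr (Filter.Eventually.of_forall fun p ↦ ?_)
    -- The slice at `p = (u, k)` is the right translate by `k⁻¹` of the section of `N` over `u`;
    -- right translation preserves Haar null sets even when `G` is not unimodular.
    exact measure_mul_right_null lam (s := Prod.mk p.1 ⁻¹' N) p.2
  have h4 : (∀ᵐ p ∂m, lam (Prod.mk p.1 ⁻¹' N) = 0) ↔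
      ∀ᵐ u ∂m.fst, lam (Prod.mk u ⁻¹' N) = 0 := by
    rw [Measure.fst, ae_map_iff measurable_fst.aemeasurable]
    exact measurable_measure_prodMk_left hN (measurableSet_singleton 0)
  rw [h1, h2, h3, h4, Measure.measure_prod_null hN]
  rfl

/-- A finite measure on `S × G` whose null sets are preserved by the left translations of `G` has a
conditional kernel that is everywhere equivalent to the Haar measure. -/
lemma exists_kernel_of_quasiInvariant [StandardBorelSpace G]
    (m : Measure (S × G)) [IsFiniteMeasure m]
    (hm : ∀ g : G, Measure.QuasiMeasurePreserving (fun p : S × G ↦ (p.1, g * p.2)) m m) :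
    ∃ κ : S → Measure G, (∀ u, IsFiniteMeasure (κ u)) ∧
      (∀ᵐ u ∂m.fst, IsProbabilityMeasure (κ u)) ∧
      (∀ u, κ u ≪ Measure.haar ∧ Measure.haar ≪ κ u) ∧
      ∀ f : S × G → ENNReal, Measurable f →
        AEMeasurable (fun u ↦ ∫⁻ g, f (u, g) ∂κ u) m.fst ∧
        ∫⁻ p, f p ∂m = ∫⁻ u, ∫⁻ g, f (u, g) ∂κ u ∂m.fst := by
  classical
  set lam : Measure G := Measure.haar
  -- A finite measure equivalent to Haar, usable both as a constant finite kernel and as a default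
  -- value for `κ`.
  set lam' : Measure G := lam.toFinite
  have hl : lam' ≪ lam := toFinite_absolutelyContinuous _
  have hl' : lam ≪ lam' := absolutelyContinuous_toFinite _
  have hm1 : m ≪ m.fst.prod lam' :=
    (Measure.AbsolutelyContinuous.mk fun N hN h ↦ (null_iff_of_quasiInvariant m hm hN).2 h).trans
      (Measure.AbsolutelyContinuous.rfl.prod hl')
  have hm2 : m.fst.prod lam' ≪ m :=
    (Measure.AbsolutelyContinuous.rfl.prod hl).trans
      (Measure.AbsolutelyContinuous.mk fun N hN h ↦ (null_iff_of_quasiInvariant m hm hN).1 h)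
  rw [← Measure.compProd_const] at hm1 hm2
  nth_rw 1 [← m.disintegrate m.condKernel] at hm1
  nth_rw 2 [← m.disintegrate m.condKernel] at hm2
  have hae : ∀ᵐ u ∂m.fst, m.condKernel u ≪ lam' ∧ lam' ≪ m.condKernel u := by
    filter_upwards [hm1.kernel_of_compProd, hm2.kernel_of_compProd] with u h1 h2
    exact ⟨by simpa using h1, by simpa using h2⟩
  -- Equivalence with Haar is wanted at every `u`, but the conditional kernel gives it only almost
  -- everywhere; on the exceptional null set it is replaced by `lam'`.
  set κ : S → Measure G := fun u ↦
    if m.condKernel u ≪ lam' ∧ lam' ≪ m.condKernel u then m.condKernel u else lam' with hκ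
  have hκae : ∀ᵐ u ∂m.fst, κ u = m.condKernel u := by
    filter_upwards [hae] with u hu
    simp only [hκ, if_pos hu]
  refine ⟨κ, fun u ↦ ?_, ?_, fun u ↦ ?_, fun f hf ↦ ⟨?_, ?_⟩⟩
  · simp only [hκ]
    split_ifs <;> infer_instance
  · filter_upwards [hκae] with u hu
    rw [hu]
    infer_instance
  · simp only [hκ]
    split_ifs with h
    · exact ⟨h.1.trans hl, hl'.trans h.2⟩
    · exact ⟨hl, hl'⟩
  · refine ⟨_, hf.lintegral_kernel_prod_right' (κ := m.condKernel), ?_⟩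
    filter_upwards [hκae] with u hu
    rw [hu]
  · conv_lhs => rw [← m.disintegrate m.condKernel]
    rw [Measure.lintegral_compProd hf]
    refine lintegral_congr_ae ?_
    filter_upwards [hκae] with u hu
    rw [hu]

end QuasiInvariant

/-! ### Equivalence of nondegenerate Gaussian measures with Lebesgue measure -/

section GaussianVolume

open ProbabilityTheory
open scoped MatrixOrder

lemma absolutelyContinuous_pi_fin {n : ℕ} {α : Fin n → Type*} [∀ i, MeasurableSpace (α i)]
    {μ ν : ∀ i, Measure (α i)} [∀ i, SigmaFinite (μ i)] [∀ i, SigmaFinite (ν i)]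
    (h : ∀ i, μ i ≪ ν i) : Measure.pi μ ≪ Measure.pi ν := by
  induction n with
  | zero =>
    rw [Measure.pi_of_empty μ default, Measure.pi_of_empty ν default]
  | succ n ih =>
    have hμ := (measurePreserving_piFinSuccAbove μ 0).symm
    have hν := (measurePreserving_piFinSuccAbove ν 0).symm
    rw [← hμ.map_eq, ← hν.map_eq]
    exact ((h 0).prod (ih fun i ↦ h _)).map (MeasurableEquiv.measurable _)

lemma stdGaussian_absolutelyContinuous (n : ℕ) :
    stdGaussian (EuclideanSpace ℝ (Fin n)) ≪ volume ∧
      volume ≪ stdGaussian (EuclideanSpace ℝ (Fin n)) := by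
  have hv := (EuclideanSpace.volume_preserving_symm_measurableEquiv_toLp (Fin n)).symm
  rw [← map_pi_eq_stdGaussian, ← hv.map_eq]
  have h1 : (1 : NNReal) ≠ 0 := one_ne_zero
  constructor
  · exact (absolutelyContinuous_pi_fin fun _ ↦ gaussianReal_absolutelyContinuous 0 h1).map
      (WithLp.measurable_toLp 2 _)
  · exact (absolutelyContinuous_pi_fin fun _ ↦ gaussianReal_absolutelyContinuous' 0 h1).map
      (WithLp.measurable_toLp 2 _)

/-- A right inverse makes the determinant nonzero, so the linear part only rescales Haar measure;
the translation preserves it. -/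
lemma quasiMeasurePreserving_affine {E : Type*} [NormedAddCommGroup E] [NormedSpace ℝ E]
    [FiniteDimensional ℝ E] [MeasurableSpace E] [BorelSpace E] (μ : Measure E)
    [μ.IsAddHaarMeasure] (v : E) (A B : E →L[ℝ] E) (hAB : A * B = 1) :
    Measure.QuasiMeasurePreserving (fun x ↦ v + A x) μ μ := by
  have hdet : LinearMap.det (A : E →ₗ[ℝ] E) ≠ 0 := by
    have h : (A : E →ₗ[ℝ] E) * (B : E →ₗ[ℝ] E) = 1 := by
      ext z
      exact DFunLike.congr_fun hAB z
    have := congrArg LinearMap.det h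
    rw [map_mul, map_one] at this
    exact left_ne_zero_of_mul_eq_one this
  refine (measurePreserving_add_left μ v).quasiMeasurePreserving.comp ⟨A.measurable, ?_⟩
  have := Measure.map_linearMap_addHaar_eq_smul_addHaar μ hdet
  rw [ContinuousLinearMap.coe_coe] at this
  rw [this]
  exact Measure.smul_absolutelyContinuous

lemma multivariateGaussian_absolutelyContinuous {n : ℕ} (v : EuclideanSpace ℝ (Fin n))
    {S : Matrix (Fin n) (Fin n) ℝ} (hS : S.PosDef) :
    multivariateGaussian v S ≪ volume ∧ volume ≪ multivariateGaussian v S := by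
  set R := CFC.sqrt S with hR
  have hRR : R * R = S := CFC.sqrt_mul_sqrt_self S (by simpa using hS.posSemidef.nonneg)
  have hdet : IsUnit R.det := by
    have h := hS.det_pos
    rw [← hRR, Matrix.det_mul] at h
    exact (left_ne_zero_of_mul h.ne').isUnit
  set A := toEuclideanCLM (𝕜 := ℝ) R
  set B := toEuclideanCLM (𝕜 := ℝ) R⁻¹
  have hAB : A * B = 1 := by
    rw [← map_mul, Matrix.mul_nonsing_inv _ hdet, map_one]
  have hBA : B * A = 1 := by
    rw [← map_mul, Matrix.nonsing_inv_mul _ hdet, map_one]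
  have hf := quasiMeasurePreserving_affine volume v A B hAB
  have hg := quasiMeasurePreserving_affine volume (-(B v)) B A hBA
  have hfg : (fun x ↦ v + A x) ∘ (fun x ↦ -(B v) + B x) = id := by
    funext x
    have h1 : A (B v) = v := DFunLike.congr_fun hAB v
    have h2 : A (B x) = x := DFunLike.congr_fun hAB x
    simp [map_add, map_neg, h1, h2]
  obtain ⟨h1, h2⟩ := stdGaussian_absolutelyContinuous n
  rw [multivariateGaussian]
  refine ⟨(h1.map hf.measurable).trans hf.absolutelyContinuous, ?_⟩
  -- With `f = v + A ·` and `g` its inverse: `volume = f_* g_* volume ≪ f_* volume ≪ f_*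
  -- stdGaussian`.
  have h3 := (hg.absolutelyContinuous.map hf.measurable).trans (h2.map hf.measurable)
  rwa [Measure.map_map hf.measurable hg.measurable, hfg, Measure.map_id] at h3

end GaussianVolume

/-! ### The RBF kernel matrix is positive definite -/

section KernelPosDef

open ProbabilityTheory Complex
open scoped ComplexConjugate InnerProductSpace

/-- The character `ω ↦ exp (i ⟪ω, z⟫)`, as a homomorphism to the multiplicative monoid of `ℂ`. -/
def expCharacter {E : Type*} [NormedAddCommGroup E] [InnerProductSpace ℝ E] (z : E) :
    Multiplicative E →* ℂ where
  toFun w := exp (⟪w.toAdd, z⟫_ℝ * I)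
  map_one' := by simp
  map_mul' v w := by simp [inner_add_left, add_mul, exp_add]

lemma expCharacter_injective {E : Type*} [NormedAddCommGroup E] [InnerProductSpace ℝ E] :
    Function.Injective (expCharacter (E := E)) := by
  intro y z hyz
  by_contra hne
  have hr : ‖y - z‖ ^ 2 ≠ 0 := pow_ne_zero 2 (norm_ne_zero_iff.2 (sub_ne_zero.2 hne))
  -- Scaled so that `⟪w, y⟫` and `⟪w, z⟫` differ by π: the two characters then take opposite nonzero
  -- values at `w`.
  set w : E := (Real.pi / ‖y - z‖ ^ 2) • (y - z)
  have h : exp (⟪w, y⟫_ℝ * I) = exp (⟪w, z⟫_ℝ * I) :=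
    DFunLike.congr_fun hyz (Multiplicative.ofAdd w)
  have hw : ⟪w, y⟫_ℝ = Real.pi + ⟪w, z⟫_ℝ := by
    rw [← sub_eq_iff_eq_add, ← inner_sub_right, real_inner_smul_left, real_inner_self_eq_norm_sq,
      div_mul_cancel₀ _ hr]
  rw [hw, ofReal_add, add_mul, exp_add, exp_pi_mul_I] at h
  have h0 := exp_ne_zero (⟪w, z⟫_ℝ * I)
  apply h0
  linear_combination (-1 / 2 : ℂ) * h

/-- Since `exp (-‖v‖² / 2)` is the characteristic function of the standard Gaussian, the quadratic
form equals `∫ ‖F‖²` with `F` a combination of characters. If it vanished, `F` would be zero almost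
everywhere, hence everywhere by continuity and full support, against the linear independence of
distinct characters. -/
lemma sum_exp_neg_norm_sq_pos {m k : ℕ} (z : Fin m → EuclideanSpace ℝ (Fin k))
    (hz : Function.Injective z) (c : Fin m → ℝ) (hc : c ≠ 0) :
    0 < ∑ i, ∑ j, c i * c j * Real.exp (-‖z i - z j‖ ^ 2 / 2) := by
  set γ : Measure (EuclideanSpace ℝ (Fin k)) := stdGaussian (EuclideanSpace ℝ (Fin k))
  set F : EuclideanSpace ℝ (Fin k) → ℂ := fun w ↦ ∑ i, c i * exp (⟪w, z i⟫_ℝ * I) with hF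
  have hFc : Continuous F := by fun_prop
  have hbound : ∀ w, ‖F w‖ ≤ ∑ i, |c i| := fun w ↦ by
    refine (norm_sum_le _ _).trans (Finset.sum_le_sum fun i _ ↦ ?_)
    simp [norm_exp_ofReal_mul_I]
  have hFi : Integrable (fun w ↦ ‖F w‖ ^ 2) γ := by
    refine Integrable.of_bound (by fun_prop) ((∑ i, |c i|) ^ 2)
      (Filter.Eventually.of_forall fun w ↦ ?_)
    rw [norm_pow, norm_norm]
    exact pow_le_pow_left₀ (norm_nonneg _) (hbound w) 2
  have hexp : ∀ v : EuclideanSpace ℝ (Fin k), Integrable (fun w ↦ exp (⟪w, v⟫_ℝ * I)) γ := fun v ↦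
    Integrable.of_bound (by fun_prop) 1
      (Filter.Eventually.of_forall fun w ↦ by simp [norm_exp_ofReal_mul_I])
  have hsq : ∀ w, ((‖F w‖ ^ 2 : ℝ) : ℂ) =
      ∑ i, ∑ j, (c i * c j : ℂ) * exp (⟪w, z i - z j⟫_ℝ * I) := fun w ↦ by
    rw [ofReal_pow, ← Complex.mul_conj', hF]
    simp only [map_sum, Finset.sum_mul_sum]
    refine Finset.sum_congr rfl fun i _ ↦ Finset.sum_congr rfl fun j _ ↦ ?_
    rw [map_mul, conj_ofReal, ← Complex.exp_conj, map_mul, conj_ofReal, conj_I, inner_sub_right,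
      ofReal_sub, sub_mul, sub_eq_add_neg, exp_add]
    ring_nf
  have hint : ∫ w, ‖F w‖ ^ 2 ∂γ =
      ∑ i, ∑ j, c i * c j * Real.exp (-‖z i - z j‖ ^ 2 / 2) := by
    apply ofReal_injective
    rw [← integral_complex_ofReal]
    simp only [hsq]
    rw [integral_finsetSum _ fun i _ ↦ integrable_finsetSum _ fun j _ ↦ (hexp _).const_mul _]
    push_cast
    refine Finset.sum_congr rfl fun i _ ↦ ?_
    rw [integral_finsetSum _ fun j _ ↦ (hexp _).const_mul _]
    refine Finset.sum_congr rfl fun j _ ↦ ?_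
    rw [integral_const_mul, ← charFun_apply, charFun_stdGaussian]
  rw [← hint]
  refine lt_of_le_of_ne (integral_nonneg fun w ↦ by positivity) fun h0 ↦ hc ?_
  have hae : F =ᵐ[γ] 0 := by
    filter_upwards [(integral_eq_zero_iff_of_nonneg (fun w ↦ by positivity) hFi).1 h0.symm]
      with w hw
    simpa using hw
  have : γ.IsOpenPosMeasure := (stdGaussian_absolutelyContinuous k).2.isOpenPosMeasure
  have hF0 : F = 0 := Continuous.ae_eq_iff_eq γ hFc continuous_zero |>.1 hae
  have hli := (linearIndependent_monoidHom (Multiplicative (EuclideanSpace ℝ (Fin k))) ℂ).comp (fun i ↦ expCharacter (z i))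
    (expCharacter_injective.comp hz)
  rw [Fintype.linearIndependent_iff] at hli
  funext i
  have := hli (fun i ↦ (c i : ℂ)) (by
    funext w
    have := congrFun hF0 w.toAdd
    simpa [hF, expCharacter] using this) i
  simpa using this

lemma posDef_rbfKernel {n d : ℕ} {σ : ℝ} (hσ : 0 < σ) {x : Fin n → EuclideanSpace ℝ (Fin d)}
    (hx : Function.Injective x) : (rbfKernel σ x x).PosDef := by
  rw [posDef_iff_dotProduct_mulVec]
  refine ⟨?_, fun c hc ↦ ?_⟩
  · ext i j
    simp [rbfKernel, norm_sub_rev (x i) (x j)]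
  · have hz : Function.Injective fun i ↦ σ⁻¹ • x i :=
      (smul_right_injective _ (inv_ne_zero hσ.ne')).comp hx
    convert! sum_exp_neg_norm_sq_pos _ hz c hc using 1
    simp only [dotProduct, mulVec, Finset.mul_sum, rbfKernel, Matrix.of_apply, Pi.star_apply,
      star_trivial]
    refine Finset.sum_congr rfl fun i _ ↦ Finset.sum_congr rfl fun j _ ↦ ?_
    rw [← smul_sub, norm_smul, norm_inv, Real.norm_of_nonneg hσ.le]
    field_simp

end KernelPosDef

/-! ### Orbit regularity from an equivariant trivialization -/

section Trivialization

variable {G X S : Type*} [Group G] [MulAction G X] [TopologicalSpace G] [TopologicalSpace X]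
  [TopologicalSpace S] {X₀ : Set X}

/-- If the complement of `X₀` is equivariantly homeomorphic to `S × G`, then two of its points lie
in the same orbit if and only if they have the same first coordinate. -/
lemma orbitSpace_mk_eq_iff (Φ : ↥(X₀ᶜ) ≃ₜ S × G)
    (hΦ : ∀ (u : S) (g k : G), (Φ.symm (u, g * k) : X) = g • (Φ.symm (u, k) : X))
    (x y : ↥(X₀ᶜ)) :
    OrbitSpace.mk G X₀ x = OrbitSpace.mk G X₀ y ↔ (Φ x).1 = (Φ y).1 := by
  have hquot : OrbitSpace.mk G X₀ x = OrbitSpace.mk G X₀ y ↔ ∃ g : G, g • (y : X) = (x : X) :=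
    Quotient.eq (r := orbitSetoid G X₀)
  rw [hquot]
  constructor
  · rintro ⟨g, hg⟩
    have h := hΦ (Φ y).1 g (Φ y).2
    rw [Prod.mk.eta, Φ.symm_apply_apply, hg, Subtype.val_inj, Φ.symm_apply_eq] at h
    exact (congrArg Prod.fst h).symm
  · intro h
    refine ⟨(Φ x).2 * (Φ y).2⁻¹, ?_⟩
    have h' := hΦ (Φ y).1 ((Φ x).2 * (Φ y).2⁻¹) (Φ y).2
    rw [Prod.mk.eta, Φ.symm_apply_apply, inv_mul_cancel_right, ← h, Prod.mk.eta,
      Φ.symm_apply_apply] at h'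
    exact h'.symm

/-- The orbit space of an equivariantly trivial action is the base of the trivialization. -/
def orbitSpaceHomeomorph (Φ : ↥(X₀ᶜ) ≃ₜ S × G)
    (hΦ : ∀ (u : S) (g k : G), (Φ.symm (u, g * k) : X) = g • (Φ.symm (u, k) : X)) :
    OrbitSpace G X₀ ≃ₜ S where
  toFun := Quotient.lift (fun x ↦ (Φ x).1) fun x y h ↦
    (orbitSpace_mk_eq_iff Φ hΦ x y).1 (Quotient.sound h)
  invFun u := OrbitSpace.mk G X₀ (Φ.symm (u, 1))
  left_inv o := by
    induction o using Quotient.inductionOn with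
    | h x => exact (orbitSpace_mk_eq_iff Φ hΦ _ x).2 (by simp)
  right_inv u := by simp [OrbitSpace.mk]
  continuous_toFun := Continuous.quotient_lift (continuous_fst.comp Φ.continuous) _
  continuous_invFun :=
    continuous_quotient_mk'.comp (Φ.symm.continuous.comp (by fun_prop))

@[simp] lemma orbitSpaceHomeomorph_mk (Φ : ↥(X₀ᶜ) ≃ₜ S × G)
    (hΦ : ∀ (u : S) (g k : G), (Φ.symm (u, g * k) : X) = g • (Φ.symm (u, k) : X)) (x : ↥(X₀ᶜ)) :
    orbitSpaceHomeomorph Φ hΦ (OrbitSpace.mk G X₀ x) = (Φ x).1 := rfl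

lemma mem_fiber_iff (Φ : ↥(X₀ᶜ) ≃ₜ S × G)
    (hΦ : ∀ (u : S) (g k : G), (Φ.symm (u, g * k) : X) = g • (Φ.symm (u, k) : X))
    (o : OrbitSpace G X₀) (x : ↥(X₀ᶜ)) :
    (x : X) ∈ OrbitSpace.fiber G X₀ o ↔ (Φ x).1 = orbitSpaceHomeomorph Φ hΦ o := by
  rw [OrbitSpace.fiber, Subtype.val_injective.mem_set_image, Set.mem_preimage,
    Set.mem_singleton_iff, ← (orbitSpaceHomeomorph Φ hΦ).injective.eq_iff,
    orbitSpaceHomeomorph_mk]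

variable [IsTopologicalGroup G] [LocallyCompactSpace G] [SigmaCompactSpace G] [PolishSpace G]
  [MeasurableSpace G] [BorelSpace G] [MeasurableSpace X] [PolishSpace X] [BorelSpace X]
  [SecondCountableTopology S] [T2Space S]

/-- A probability measure that is quasi-invariant under an action which is equivariantly trivial
off a closed null set is orbit-regular. -/
theorem orbitRegularOff_of_trivialization (μ : Measure X) [IsProbabilityMeasure μ]
    (hX₀ : IsClosed X₀) (hnull : μ X₀ = 0)
    (hμ : ∀ g : G, Measure.QuasiMeasurePreserving (fun x : X ↦ g • x) μ μ)
    (Φ : ↥(X₀ᶜ) ≃ₜ S × G)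
    (hΦ : ∀ (u : S) (g k : G), (Φ.symm (u, g * k) : X) = g • (Φ.symm (u, k) : X)) :
    OrbitRegularOff G μ X₀ := by
  borelize S
  have hpt : ∀ x : ↥(X₀ᶜ), ∀ g : G, g • (x : X) = Φ.symm ((Φ x).1, g * (Φ x).2) := fun x g ↦ by
    rw [hΦ, Prod.mk.eta, Φ.symm_apply_apply]
  have hX₀m : MeasurableSet (X₀ᶜ) := hX₀.measurableSet.compl
  have hval := MeasurableEmbedding.subtype_coe hX₀m
  set m : Measure (S × G) := (μ.comap (Subtype.val : ↥(X₀ᶜ) → X)).map Φ with hm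
  have hmeas : Measurable Φ := Φ.continuous.measurable
  have hmN : ∀ N : Set (S × G), MeasurableSet N → m N = μ (Subtype.val '' (Φ ⁻¹' N)) := by
    intro N hN
    rw [hm, Measure.map_apply hmeas hN, hval.comap_apply]
  have : IsFiniteMeasure m := ⟨by rw [hmN _ MeasurableSet.univ]; exact measure_lt_top _ _⟩
  have hmq : ∀ g : G, Measure.QuasiMeasurePreserving (fun p : S × G ↦ (p.1, g * p.2)) m m := by
    intro g
    have hgm : Measurable (fun p : S × G ↦ (p.1, g * p.2)) :=
      (by fun_prop : Continuous (fun p : S × G ↦ (p.1, g * p.2))).measurable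
    refine ⟨hgm, Measure.AbsolutelyContinuous.mk fun N hN h ↦ ?_⟩
    rw [Measure.map_apply hgm hN, hmN _ (hgm hN)]
    rw [hmN N hN] at h
    refine measure_mono_null ?_ ((hμ g).preimage_null h)
    rintro _ ⟨x, hx, rfl⟩
    refine ⟨Φ.symm ((Φ x).1, g * (Φ x).2), ?_, (hpt x g).symm⟩
    simpa using hx
  obtain ⟨κ, hfin, hprob, hac, hint⟩ := exists_kernel_of_quasiInvariant m hmq
  set H := orbitSpaceHomeomorph Φ hΦ with hH
  have hmkc : Continuous (OrbitSpace.mk G X₀) := continuous_quotient_mk'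
  have hmk : Measurable (OrbitSpace.mk G X₀) := hmkc.measurable
  have hpres : MeasurePreserving H (orbitLaw G μ X₀) m.fst := by
    refine ⟨H.continuous.measurable, ?_⟩
    rw [orbitLaw, Measure.map_map H.continuous.measurable hmk, Measure.fst, hm,
      Measure.map_map measurable_fst hmeas]
    rfl
  set Ψ : S → G → X := fun u g ↦ Φ.symm (u, g) with hΨ
  have hΨc : Continuous (Function.uncurry Ψ) := continuous_subtype_val.comp Φ.symm.continuous
  have hΨu : ∀ u, Continuous (Ψ u) := fun u ↦ hΨc.comp (Continuous.prodMk_right u)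
  set K : OrbitSpace G X₀ → Measure X := fun o ↦ (κ (H o)).map (Ψ (H o)) with hK
  have hKl : ∀ (f : X → ENNReal), Measurable f → ∀ o,
      ∫⁻ x, f x ∂(K o) = ∫⁻ g, f (Ψ (H o) g) ∂κ (H o) := fun f hf o ↦
    lintegral_map hf (hΨu _).measurable
  have hfΨ : ∀ (f : X → ENNReal), Measurable f → Measurable fun p : S × G ↦ f (Ψ p.1 p.2) :=
    fun f hf ↦ hf.comp hΨc.measurable
  refine ⟨fun g x hx ↦ ?_, hX₀, hnull, fun x hx g hg ↦ ?_, K, ⟨fun o ↦ ?_, ?_, fun f hf ↦ ?_,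
    fun f hf ↦ ?_⟩, fun x ↦ ?_⟩
  -- If `g • x` lay outside `X₀`, so would `x = g⁻¹ • (g • x)`, because `hpt` writes it as a value
  -- of `Φ.symm`.
  · by_contra hgx
    have h := hpt ⟨g • x, hgx⟩ g⁻¹
    rw [inv_smul_smul] at h
    have h' : x ∈ X₀ᶜ := h ▸ Subtype.coe_prop _
    exact h' hx
  · have h := hpt ⟨x, hx⟩ g
    rw [show g • ((⟨x, hx⟩ : ↥(X₀ᶜ)) : X) = ((⟨x, hx⟩ : ↥(X₀ᶜ)) : X) from hg, Subtype.val_inj,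
      ← Φ.symm_apply_apply ⟨x, hx⟩, Φ.symm.injective.eq_iff, Φ.apply_symm_apply] at h
    simpa using (congrArg Prod.snd h).symm
  · have := hfin (H o)
    have : IsFiniteMeasure (K o) := Measure.isFiniteMeasure_map _ _
    -- Finite Borel measures on a Polish group are inner regular, and continuous images keep this.
    let := TopologicalSpace.upgradeIsCompletelyMetrizable G
    exact ⟨inferInstance, Measure.InnerRegular.map_of_continuous (hΨu _)⟩
  · filter_upwards [hpres.quasiMeasurePreserving.ae hprob] with o ho
    refine ⟨Measure.isProbabilityMeasure_map (hΨu _).measurable.aemeasurable, ?_⟩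
    have hfib : OrbitSpace.fiber G X₀ o =
        Subtype.val '' ((fun x : ↥(X₀ᶜ) ↦ (Φ x).1) ⁻¹' {H o}) := by
      ext x
      constructor
      · rintro ⟨x, hx, rfl⟩
        refine ⟨x, ?_, rfl⟩
        rw [← hx]
        rfl
      · rintro ⟨x, hx, rfl⟩
        exact (mem_fiber_iff Φ hΦ o x).2 hx
    have hmf : MeasurableSet (OrbitSpace.fiber G X₀ o) := by
      rw [hfib]
      exact hval.measurableSet_image.2
        ((continuous_fst.comp Φ.continuous).measurable (measurableSet_singleton _))
    rw [hK, Measure.map_apply (hΨu _).measurable hmf.compl]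
    convert measure_empty (μ := κ (H o))
    ext g
    simp only [Set.mem_preimage, Set.mem_compl_iff, Set.mem_empty_iff_false, iff_false, not_not]
    rw [hΨ, mem_fiber_iff Φ hΦ]
    simp [hH]
  · simp_rw [hKl f hf]
    exact (hint _ (hfΨ f hf)).1.comp_quasiMeasurePreserving hpres.quasiMeasurePreserving
  · simp_rw [hKl f hf]
    rw [hpres.lintegral_comp_emb H.measurableEmbedding
      (fun u ↦ ∫⁻ g, f (Ψ u g) ∂κ u), ← (hint _ (hfΨ f hf)).2, hm,
      lintegral_map (hfΨ f hf) hmeas, ← lintegral_subtype_comap hX₀m]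
    simp [hΨ]
  · have hKx : K (OrbitSpace.mk G X₀ x) = (κ (Φ x).1).map (Ψ (Φ x).1) := rfl
    have hmul : Measurable fun g : G ↦ g * (Φ x).2 := measurable_mul_const _
    -- The base point enters only through a right translation by its group coordinate, which
    -- preserves the Haar null sets.
    have hhaar : orbitHaar G (x : X) =
        ((Measure.haar : Measure G).map (fun g ↦ g * (Φ x).2)).map (Ψ (Φ x).1) := by
      rw [Measure.map_map (hΨu _).measurable hmul, orbitHaar]
      congr 1
      funext g
      exact hpt x g
    rw [hKx, hhaar]
    exact ⟨((hac _).1.trans (absolutelyContinuous_map_mul_right _ _)).map (hΨu _).measurable,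
      ((quasiMeasurePreserving_mul_right _ _).absolutelyContinuous.trans (hac _).2).map
        (hΨu _).measurable⟩

end Trivialization

variable {n d : ℕ}

/-! ### The trivialization of the action of `GPGroup` -/

section Action

instance : PolishSpace (GPGroup d) := by
  have := GPGroup.isOpenEmbedding_toProd (d := d)
  have : PolishSpace (Set.range (GPGroup.toProd (d := d))) := this.isOpen_range.polishSpace
  exact (GPGroup.isOpenEmbedding_toProd (d := d)).toIsEmbedding.toHomeomorph.isClosedEmbedding
    |>.polishSpace

/-- `linMean` as a linear map. -/
def linMeanₗ (x : Fin n → EuclideanSpace ℝ (Fin d)) :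
    EuclideanSpace ℝ (Fin d) →ₗ[ℝ] EuclideanSpace ℝ (Fin n) where
  toFun := linMean x
  map_add' b c := by simp [linMean, Matrix.mulVec_add]
  map_smul' a b := by simp [linMean, Matrix.mulVec_smul]

@[simp] lemma linMeanₗ_apply (x : Fin n → EuclideanSpace ℝ (Fin d))
    (b : EuclideanSpace ℝ (Fin d)) : linMeanₗ x b = linMean x b := rfl

lemma range_linMeanₗ (x : Fin n → EuclideanSpace ℝ (Fin d)) :
    LinearMap.range (linMeanₗ x) = rowSpace x := by
  rw [LinearMap.range_eq_map, ← (EuclideanSpace.basisFun (Fin d) ℝ).toBasis.span_eq,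
    Submodule.map_span, ← Set.range_comp, rowSpace]
  congr 2
  funext j
  ext i
  simp [linMean]

lemma linMeanₗ_injective {x : Fin n → EuclideanSpace ℝ (Fin d)} (hrank : (design x).rank = d) :
    Function.Injective (linMeanₗ x) := by
  have h : Function.Injective (design x)ᵀ.mulVecLin := by
    rw [← LinearMap.ker_eq_bot, ← Submodule.finrank_eq_zero (R := ℝ)]
    have h1 := LinearMap.finrank_range_add_finrank_ker (design x)ᵀ.mulVecLin
    have h2 : Module.finrank ℝ (LinearMap.range (design x)ᵀ.mulVecLin) = d :=
      (Matrix.rank_transpose (design x)).trans hrank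
    rw [h2, Module.finrank_fin_fun] at h1
    omega
  intro b c hbc
  exact WithLp.ofLp_injective 2 (h (WithLp.toLp_injective 2 hbc))

/-- Linear coordinates on `ℝⁿ` in which the translations act on the first component only. -/
lemma exists_coordinates (hnd : d < n) {x : Fin n → EuclideanSpace ℝ (Fin d)}
    (hrank : (design x).rank = d) :
    ∃ e : EuclideanSpace ℝ (Fin n) ≃L[ℝ]
        EuclideanSpace ℝ (Fin d) × EuclideanSpace ℝ (Fin (n - d - 1 + 1)),
      (∀ b, e (linMean x b) = (b, 0)) ∧ ∀ y, y ∈ rowSpace x ↔ (e y).2 = 0 := by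
  have hinj := linMeanₗ_injective hrank
  obtain ⟨C, hC⟩ := (LinearMap.range (linMeanₗ x)).exists_isCompl
  -- This is `n - d`, as `d < n`; the successor form matches a sphere of dimension `n - d - 1`.
  have hfr : Module.finrank ℝ C = n - d - 1 + 1 := by
    have h1 := Submodule.finrank_add_eq_of_isCompl hC
    rw [LinearMap.finrank_range_of_inj hinj, finrank_euclideanSpace_fin,
      finrank_euclideanSpace_fin] at h1
    omega
  have eC : C ≃ₗ[ℝ] EuclideanSpace ℝ (Fin (n - d - 1 + 1)) :=
    LinearEquiv.ofFinrankEq _ _ (by rw [hfr, finrank_euclideanSpace_fin])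
  set e : EuclideanSpace ℝ (Fin n) ≃L[ℝ]
      EuclideanSpace ℝ (Fin d) × EuclideanSpace ℝ (Fin (n - d - 1 + 1)) :=
    ((((LinearEquiv.ofInjective (linMeanₗ x) hinj).prodCongr eC.symm).trans
      (Submodule.prodEquivOfIsCompl _ _ hC)).symm).toContinuousLinearEquiv with he
  have hb : ∀ b, e (linMean x b) = (b, 0) := fun b ↦ by
    rw [← e.eq_symm_apply]
    simp [he, ContinuousLinearEquiv.symm]
  refine ⟨e, hb, fun y ↦ ?_⟩
  rw [← range_linMeanₗ]
  constructor
  · rintro ⟨b, rfl⟩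
    rw [linMeanₗ_apply, hb]
  · intro h
    refine ⟨(e y).1, e.injective ?_⟩
    rw [linMeanₗ_apply, hb, ← h]

/-- Polar coordinates in the second component of linear coordinates as in `exists_coordinates`. -/
def gpTrivialization {k : ℕ} {x : Fin n → EuclideanSpace ℝ (Fin d)}
    (e : EuclideanSpace ℝ (Fin n) ≃L[ℝ] EuclideanSpace ℝ (Fin d) × EuclideanSpace ℝ (Fin k))
    (he : ∀ y, y ∈ rowSpace x ↔ (e y).2 = 0) :
    ↥((rowSpace x : Set (EuclideanSpace ℝ (Fin n)))ᶜ) ≃ₜ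
      Metric.sphere (0 : EuclideanSpace ℝ (Fin k)) 1 × GPGroup d :=
  have hne (y : ↥((rowSpace x : Set (EuclideanSpace ℝ (Fin n)))ᶜ)) : ‖(e y).2‖ ≠ 0 :=
    norm_ne_zero_iff.2 fun h ↦ y.2 ((he y).2 h)
  have hsph (u : Metric.sphere (0 : EuclideanSpace ℝ (Fin k)) 1) :
      ‖(u : EuclideanSpace ℝ (Fin k))‖ = 1 := mem_sphere_zero_iff_norm.1 u.2
  have hcont : Continuous fun y : ↥((rowSpace x : Set (EuclideanSpace ℝ (Fin n)))ᶜ) ↦ e y :=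
    e.continuous.comp continuous_subtype_val
  -- With `e y = (b', w)`, the point `y` is the image of `e.symm (0, w / ‖w‖)` under the group
  -- element `(‖w‖, b')`.
  { toFun := fun y ↦
      (⟨‖(e y).2‖⁻¹ • (e y).2, mem_sphere_zero_iff_norm.2 (norm_smul_inv_norm
        (𝕜 := ℝ) (norm_ne_zero_iff.1 (hne y)))⟩,
        ⟨‖(e y).2‖, (norm_nonneg _).lt_of_ne' (hne y), (e y).1⟩)
    invFun := fun p ↦ ⟨e.symm (p.2.b, p.2.a • (p.1 : EuclideanSpace ℝ (Fin k))), fun h ↦ by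
      have h0 := (he _).1 h
      rw [e.apply_symm_apply, smul_eq_zero] at h0
      have h1 := hsph p.1
      rcases h0 with h0 | h0
      · exact p.2.a_pos.ne' h0
      · rw [h0, norm_zero] at h1
        exact zero_ne_one h1⟩
    left_inv := fun y ↦ by
      refine Subtype.ext (e.injective ?_)
      simp only [e.apply_symm_apply]
      rw [smul_inv_smul₀ (hne y)]
    right_inv := fun ⟨u, g⟩ ↦ by
      have hn : ‖g.a • (u : EuclideanSpace ℝ (Fin k))‖ = g.a := by
        rw [norm_smul, hsph, mul_one, Real.norm_of_nonneg g.a_pos.le]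
      refine Prod.ext (Subtype.ext ?_) (GPGroup.ext ?_ ?_)
      · simp only [e.apply_symm_apply]
        rw [hn, inv_smul_smul₀ g.a_pos.ne']
      · simp only [e.apply_symm_apply]
        exact hn
      · simp only [e.apply_symm_apply]
    continuous_toFun := by
      refine Continuous.prodMk (Continuous.subtype_mk ?_ _)
        (GPGroup.isInducing_toProd.continuous_iff.2 ?_)
      · exact (hcont.snd.norm.inv₀ hne).smul hcont.snd
      · exact hcont.snd.norm.prodMk hcont.fst
    continuous_invFun := by
      refine Continuous.subtype_mk (e.symm.continuous.comp ?_) _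
      exact (GPGroup.continuous_b.comp continuous_snd).prodMk
        ((GPGroup.continuous_a.comp continuous_snd).smul
          (continuous_subtype_val.comp continuous_fst)) }

lemma gpTrivialization_symm_mul {k : ℕ} {x : Fin n → EuclideanSpace ℝ (Fin d)}
    (e : EuclideanSpace ℝ (Fin n) ≃L[ℝ] EuclideanSpace ℝ (Fin d) × EuclideanSpace ℝ (Fin k))
    (he : ∀ y, y ∈ rowSpace x ↔ (e y).2 = 0) (hb : ∀ b, e (linMean x b) = (b, 0))
    (u : Metric.sphere (0 : EuclideanSpace ℝ (Fin k)) 1) (g h : GPGroup d) :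
    ((gpTrivialization e he).symm (u, g * h) : EuclideanSpace ℝ (Fin n)) =
      g.a • ((gpTrivialization e he).symm (u, h) : EuclideanSpace ℝ (Fin n)) +
        linMean x g.b := by
  change e.symm ((g * h).b, (g * h).a • (u : EuclideanSpace ℝ (Fin k))) =
    g.a • e.symm (h.b, h.a • (u : EuclideanSpace ℝ (Fin k))) + linMean x g.b
  apply e.injective
  rw [map_add, map_smul, hb, e.apply_symm_apply, e.apply_symm_apply]
  simp [mul_smul]

/-- The nondegenerate Gaussian law is quasi-invariant under scalings and translations. -/
lemma quasiMeasurePreserving_gpAction {σx σy : ℝ} (hσx : 0 < σx) (hσy : 0 < σy)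
    {x : Fin n → EuclideanSpace ℝ (Fin d)} (hx : Function.Injective x)
    (β : EuclideanSpace ℝ (Fin d)) (g : GPGroup d) :
    Measure.QuasiMeasurePreserving (fun y ↦ g.a • y + linMean x g.b)
      (gpLaw σx σy x β) (gpLaw σx σy x β) := by
  have hS : (σy ^ 2 • rbfKernel σx x x).PosDef := (posDef_rbfKernel hσx hx).smul (by positivity)
  obtain ⟨h1, h2⟩ := multivariateGaussian_absolutelyContinuous (linMean x β) hS
  have h := quasiMeasurePreserving_affine (volume : Measure (EuclideanSpace ℝ (Fin n)))
    (linMean x g.b) (g.a • 1) (g.a⁻¹ • 1) (by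
      rw [smul_mul_smul_comm, mul_inv_cancel₀ g.a_pos.ne', one_smul, one_mul])
  convert! h.mono h1 h2 using 1
  funext y
  simp [add_comm]

/-- The row space has dimension at most `d < n`, so it is a proper subspace and Lebesgue-null. -/
lemma gpLaw_rowSpace (hnd : d < n) {σx σy : ℝ} (hσx : 0 < σx) (hσy : 0 < σy)
    {x : Fin n → EuclideanSpace ℝ (Fin d)} (hx : Function.Injective x)
    (β : EuclideanSpace ℝ (Fin d)) :
    gpLaw σx σy x β (rowSpace x : Set (EuclideanSpace ℝ (Fin n))) = 0 := by
  have hS : (σy ^ 2 • rbfKernel σx x x).PosDef := (posDef_rbfKernel hσx hx).smul (by positivity)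
  refine (multivariateGaussian_absolutelyContinuous (linMean x β) hS).1 ?_
  refine Measure.addHaar_submodule _ _ fun htop ↦ ?_
  have h1 := LinearMap.finrank_range_le (linMeanₗ x)
  rw [range_linMeanₗ, htop, finrank_top, finrank_euclideanSpace_fin,
    finrank_euclideanSpace_fin] at h1
  omega

/-- The stabilizers of exactly the points of the row space are nontrivial. -/
lemma stabilizer_trivial_iff {x : Fin n → EuclideanSpace ℝ (Fin d)}
    (hrank : (design x).rank = d) (y : EuclideanSpace ℝ (Fin n)) :
    (∀ g : GPGroup d, g.a • y + linMean x g.b = y → g = 1) ↔ y ∉ rowSpace x := by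
  constructor
  · intro h hy
    rw [← range_linMeanₗ] at hy
    obtain ⟨c, rfl⟩ := hy
    -- For `y = linMean x c`, any `(a, (1 - a) c)` fixes `y`; here `a = 2`.
    have h2 := h ⟨2, two_pos, -c⟩ (by
      rw [← linMeanₗ_apply x (-c), map_neg, two_smul, add_neg_cancel_right])
    have := congrArg GPGroup.a h2
    norm_num at this
  · intro hy g hg
    -- The fixed-point equation reads `(1 - a) y = linMean x b`.
    have hmem : (1 - g.a) • y ∈ rowSpace x := by
      rw [← range_linMeanₗ]
      refine ⟨g.b, ?_⟩
      rw [linMeanₗ_apply, sub_smul, one_smul, eq_sub_iff_add_eq, add_comm]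
      exact hg
    have ha : g.a = 1 := by
      by_contra hne
      exact hy (((rowSpace x).smul_mem_iff (sub_ne_zero.2 (Ne.symm hne))).1 hmem)
    rw [ha, one_smul, add_eq_left] at hg
    exact GPGroup.ext ha (linMeanₗ_injective hrank (hg.trans (map_zero (linMeanₗ x)).symm))

end Action

/-! ### Smoothness of the spherical coordinate -/

section Submersion

/-- By the chain rule the differential of the section is a right inverse of that of `f`. -/
lemma mfderiv_surjective_of_rightInverse {p q : ℕ} {M N : Type*}
    [TopologicalSpace M] [ChartedSpace (EuclideanSpace ℝ (Fin p)) M]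
    [TopologicalSpace N] [ChartedSpace (EuclideanSpace ℝ (Fin q)) N] {f : M → N} {s : N → M}
    (hfs : Function.LeftInverse f s) {u : N} {y : M} (hsy : s u = y)
    (hs : MDifferentiableAt (𝓡 q) (𝓡 p) s u) (hf : MDifferentiableAt (𝓡 p) (𝓡 q) f y) :
    Function.Surjective (mfderiv (𝓡 p) (𝓡 q) f y) := by
  subst hsy
  have hcomp := mfderiv_comp u hf hs
  rw [hfs.comp_eq_id, mfderiv_id] at hcomp
  have hsurj : Function.Surjective
      ((mfderiv (𝓡 p) (𝓡 q) f (s u)).comp (mfderiv (𝓡 q) (𝓡 p) s u)) := by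
    rw [← hcomp]
    exact fun w ↦ ⟨w, rfl⟩
  exact Function.Surjective.of_comp hsurj

lemma contMDiff_coe_sphere_euclidean (q : ℕ) :
    ContMDiff (𝓡 q) 𝓘(ℝ, EuclideanSpace ℝ (Fin (q + 1))) ∞
      (Subtype.val : Metric.sphere (0 : EuclideanSpace ℝ (Fin (q + 1))) 1 → _) :=
  haveI := Fact.mk (finrank_euclideanSpace_fin (𝕜 := ℝ) (n := q + 1))
  contMDiff_coe_sphere

lemma contMDiff_codRestrict_sphere {p q : ℕ} {M : Type*} [TopologicalSpace M]
    [ChartedSpace (EuclideanSpace ℝ (Fin p)) M] [IsManifold (𝓡 p) ∞ M] {f : M → EuclideanSpace ℝ (Fin (q + 1))}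
    (hf : ContMDiff (𝓡 p) 𝓘(ℝ, EuclideanSpace ℝ (Fin (q + 1))) ∞ f)
    (hf' : ∀ y, f y ∈ Metric.sphere (0 : EuclideanSpace ℝ (Fin (q + 1))) 1) :
    ContMDiff (𝓡 p) (𝓡 q) ∞
      (Set.codRestrict f (Metric.sphere (0 : EuclideanSpace ℝ (Fin (q + 1))) 1) hf') :=
  haveI := Fact.mk (finrank_euclideanSpace_fin (𝕜 := ℝ) (n := q + 1))
  hf.codRestrict_sphere hf'

/-- The spherical coordinate of the trivialization is a smooth submersion. -/
lemma isSmoothSubmersion_gpTrivialization {q : ℕ} {x : Fin n → EuclideanSpace ℝ (Fin d)}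
    (e : EuclideanSpace ℝ (Fin n) ≃L[ℝ]
      EuclideanSpace ℝ (Fin d) × EuclideanSpace ℝ (Fin (q + 1)))
    (he : ∀ y, y ∈ rowSpace x ↔ (e y).2 = 0) :
    IsSmoothSubmersion (p := n) (q := q)
      (fun y : rowCompl x ↦ (gpTrivialization e he ⟨y.1, y.2⟩).1) := by
  set f : rowCompl x → Metric.sphere (0 : EuclideanSpace ℝ (Fin (q + 1))) 1 :=
    fun y ↦ (gpTrivialization e he ⟨y.1, y.2⟩).1
  have hf : ContMDiff (𝓡 n) (𝓡 q) ∞ f := by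
    have hF : ContMDiff (𝓡 n) 𝓘(ℝ, EuclideanSpace ℝ (Fin (q + 1))) ∞
        (fun y : rowCompl x ↦ ‖(e (y : EuclideanSpace ℝ (Fin n))).2‖⁻¹ •
          (e (y : EuclideanSpace ℝ (Fin n))).2) := by
      intro y
      have hy : (e (y : EuclideanSpace ℝ (Fin n))).2 ≠ 0 := fun h ↦ y.2 ((he y).2 h)
      refine (contMDiffAt_subtype_iff (f := fun y : EuclideanSpace ℝ (Fin n) ↦
        ‖(e y).2‖⁻¹ • (e y).2)).2 (ContDiffAt.contMDiffAt ?_)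
      have hE : ContDiffAt ℝ ∞ (fun y : EuclideanSpace ℝ (Fin n) ↦ (e y).2) y :=
        (contDiff_snd.comp e.contDiff).contDiffAt
      exact ((hE.norm ℝ hy).inv (norm_ne_zero_iff.2 hy)).smul hE
    exact contMDiff_codRestrict_sphere hF fun y ↦ (f y).2
  refine ⟨hf, fun y ↦ ?_⟩
  set p := gpTrivialization e he ⟨y.1, y.2⟩ with hp
  -- The smooth section of `f` through `y`: the group coordinate of `y` is kept fixed and only the
  -- direction varies.
  set s : Metric.sphere (0 : EuclideanSpace ℝ (Fin (q + 1))) 1 → rowCompl x :=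
    fun u ↦ ⟨((gpTrivialization e he).symm (u, p.2)).1,
      ((gpTrivialization e he).symm (u, p.2)).2⟩
  have hs : ContMDiff (𝓡 q) (𝓡 n) ∞ s := by
    rw [← ContMDiff.subtypeVal_comp_iff]
    have hS : ContDiff ℝ ∞ fun v : EuclideanSpace ℝ (Fin (q + 1)) ↦ e.symm (p.2.b, p.2.a • v) :=
      e.symm.contDiff.comp (contDiff_const.prodMk (contDiff_id.const_smul p.2.a))
    exact hS.contMDiff.comp (contMDiff_coe_sphere_euclidean q)
  have hfs : Function.LeftInverse f s := fun u ↦ by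
    change ((gpTrivialization e he) ((gpTrivialization e he).symm (u, p.2))).1 = u
    rw [Homeomorph.apply_symm_apply]
  have hsy : s p.1 = y := by
    refine Subtype.ext ?_
    change ((gpTrivialization e he).symm p : EuclideanSpace ℝ (Fin n)) = y
    rw [hp, Homeomorph.symm_apply_apply]
  have hfd : MDifferentiableAt (𝓡 n) (𝓡 q) f y := hf.mdifferentiable (by simp) y
  have hsd : MDifferentiableAt (𝓡 q) (𝓡 n) s p.1 := hs.mdifferentiable (by simp) p.1
  exact mfderiv_surjective_of_rightInverse (f := f) (s := s) hfs hsy hsd hfd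

end Submersion

end OrbitReg

end

theorem mainTheorem8 {n d : ℕ} (hnd : d < n) (σx : ℝ) (hσx : 0 < σx)
    (x : Fin n → EuclideanSpace ℝ (Fin d)) (hx : Function.Injective x)
    (hrank : (OrbitReg.design x).rank = d)
    (β : EuclideanSpace ℝ (Fin d)) (σy : ℝ) (hσy : 0 < σy) :
    letI : MulAction (OrbitReg.GPGroup d) (EuclideanSpace ℝ (Fin n)) := OrbitReg.gpAction x
    OrbitReg.OrbitRegular (OrbitReg.GPGroup d) (OrbitReg.gpLaw σx σy x β) ∧
    OrbitReg.OrbitRegularOff (OrbitReg.GPGroup d) (OrbitReg.gpLaw σx σy x β)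
      (OrbitReg.rowSpace x : Set (EuclideanSpace ℝ (Fin n))) ∧
    (∀ y : EuclideanSpace ℝ (Fin n),
      (∀ g : OrbitReg.GPGroup d, g • y = y → g = 1) ↔ y ∉ OrbitReg.rowSpace x) ∧
    ∃ h : OrbitReg.gpOrbitSpace x ≃ₜ
        Metric.sphere (0 : EuclideanSpace ℝ (Fin (n - d - 1 + 1))) 1,
      OrbitReg.IsSmoothSubmersion (p := n) (q := n - d - 1)
        (fun y : OrbitReg.rowCompl x ↦ h (OrbitReg.gpQuot x y)) := by
  obtain ⟨e, hb, he⟩ := OrbitReg.exists_coordinates hnd hrank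
  let : MulAction (OrbitReg.GPGroup d) (EuclideanSpace ℝ (Fin n)) := OrbitReg.gpAction x
  have hΦ := OrbitReg.gpTrivialization_symm_mul e he hb
  have hreg : OrbitReg.OrbitRegularOff (OrbitReg.GPGroup d) (OrbitReg.gpLaw σx σy x β)
      (OrbitReg.rowSpace x : Set (EuclideanSpace ℝ (Fin n))) :=
    OrbitReg.orbitRegularOff_of_trivialization _
      (OrbitReg.rowSpace x).closed_of_finiteDimensional
      (OrbitReg.gpLaw_rowSpace hnd hσx hσy hx β)
      (OrbitReg.quasiMeasurePreserving_gpAction hσx hσy hx β) (OrbitReg.gpTrivialization e he) hΦ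
  -- On the class of `y` the homeomorphism is by definition the spherical coordinate of `y`, so its
  -- smoothness is the last claim.
  exact ⟨⟨_, hreg⟩, hreg, OrbitReg.stabilizer_trivial_iff hrank,
    OrbitReg.orbitSpaceHomeomorph (OrbitReg.gpTrivialization e he) hΦ,
    OrbitReg.isSmoothSubmersion_gpTrivialization e he⟩
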